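/- All groups are additively written abelian groups. A group $G$ is *cotorsion* if $\mathrm{Ext}^1(J,G)=0$ for every torsion-free group $J$, i.e. every short exact sequence $0\to G\to E\to J\to 0$ of abelian groups with $J$ torsion-free splits. A group $G$ is *co-finitely injective* if every endomorphism $\phi:G\to G$ for which $G/\phi(G)$ is finite is injective, and *Hopfian* if every surjective endomorphism of $G$ is an automorphism. Let $G$ be a cotorsion group. Then the following are equivalent: (a) $G$ is co-finitely injective; (b) $G$ is torsion-free and Hopfian; (c) $G\cong \mathbb{Q}^n\oplus\prod_p G_p$ for some integer $n\ge 0$, where the product runs over all primes $p$ and, for each prime $p$, $G_p$ is a direct sum of a finite number (possibly zero, and depending on $p$) of copies of the group $\hat{\mathbb{Z}}_p$ of $p$-adic integers. -/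

import Mathlib

universe u

/-- An abelian group `G` is cotorsion if `Ext¹(J, G) = 0` for every torsion-free abelian group `J`:
every short exact sequence `0 → G → E → J → 0` of abelian groups with `J` torsion-free splits. -/
def IsCotorsionGroup (G : Type u) [AddCommGroup G] : Prop :=
  ∀ (E J : Type u) [AddCommGroup E] [AddCommGroup J] [IsAddTorsionFree J]
    (i : G →+ E) (π : E →+ J),
    Function.Injective i → Function.Exact i π → Function.Surjective π →
      ∃ s : J →+ E, π.comp s = AddMonoidHom.id J

/-- An abelian group `G` is co-finitely injective if every endomorphism of `G` whose image has
finite index (i.e. with `G / φ(G)` finite) is injective. -/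
def IsCofinitelyInjective (G : Type u) [AddCommGroup G] : Prop :=
  ∀ φ : G →+ G, Finite (G ⧸ φ.range) → Function.Injective φ

/-- An abelian group is Hopfian if every surjective endomorphism is an automorphism. -/
def IsHopfianGroup (G : Type u) [AddCommGroup G] : Prop :=
  ∀ φ : G →+ G, Function.Surjective φ → Function.Bijective φ

instance factPrimeOfPrimes (p : Nat.Primes) : Fact (Nat.Prime (p : ℕ)) := ⟨p.2⟩

/-! (a) ⇒ (b): a surjection has trivial cokernel, so `G` is Hopfian. If `p • x = 0` and `x = p ^ n •
y` is not divisible by `p ^ (n + 1)`, then `y` generates a finite direct summand, and the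
complementary projection has finite cokernel but kills `y`, a contradiction. So elements of order
`p` have infinite `p`-height and the `p`-primary part is divisible, hence a summand. Multiplication
by `p` on it, extended by the identity on a complement, is onto, hence injective, so there is no
`p`-torsion.

(b) ⇒ (c): a torsion-free cotorsion group is its divisible part times the product of its `p`-adic
completions (`IsCotorsionGroup.exists_addEquiv_prod_pi`). The divisible part is a rational vector
space, and each completion is that of a free group on a basis of `G/pG`. An infinite basis would
give a non-Hopfian retract.

(c) ⇒ (a): if `φ` has finite cokernel, its image contains `m • G` for some `m ≠ 0`. The
`p`-component of `φ x` depends only on that of `x`, through a `ℤ_[p]`-linear map with nonzero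
determinant. So `ker φ` lies in the rational part, where `φ` is onto and dimension gives
injectivity. -/

/-! ### Retracts of Hopfian groups and splittings of cotorsion groups -/

theorem IsHopfianGroup.of_retract {G X : Type*} [AddCommGroup G] [AddCommGroup X]
    (hG : IsHopfianGroup G) (i : X →+ G) (r : G →+ X) (hri : ∀ x, r (i x) = x) :
    IsHopfianGroup X := by
  intro φ hφ
  refine ⟨?_, hφ⟩
  -- This is `φ` on the summand `X` and the identity on the complement `ker r`.
  let Φ : G →+ G := AddMonoidHom.id G - i.comp r + i.comp (φ.comp r)
  have hΦ : ∀ g, Φ g = g - i (r g) + i (φ (r g)) := fun g ↦ rfl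
  have hs : Function.Surjective Φ := by
    intro h
    obtain ⟨x, hx⟩ := hφ (r h)
    refine ⟨h - i (r h) + i x, ?_⟩
    simp [hΦ, hri, hx]
  rw [injective_iff_map_eq_zero]
  intro x hx
  have h0 : Φ (i x) = Φ 0 := by simp [hΦ, hri, hx]
  have := (hG Φ hs).1 h0
  rw [← hri x, this, map_zero]

theorem exists_surjective_not_injective (B : Type*) [Infinite B] :
    ∃ s : B → B, s.Surjective ∧ ∃ a b, a ≠ b ∧ s a = s b := by
  obtain ⟨e⟩ : Nonempty (Option B ≃ B) := by
    rw [← Cardinal.eq, Cardinal.mk_option, Cardinal.add_one_eq (Cardinal.aleph0_le_mk B)]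
  obtain ⟨b₀⟩ : Nonempty B := inferInstance
  -- The default value `b₀` makes the extra point `none` collide with `some b₀`.
  refine ⟨fun b ↦ (e.symm b).getD b₀, fun b ↦ ⟨e (some b), by simp⟩, e none, e (some b₀), ?_, ?_⟩
  · simp
  · simp

theorem IsCotorsionGroup.exists_retraction {G E : Type u} [AddCommGroup G] [AddCommGroup E]
    (hG : IsCotorsionGroup G) (i : G →+ E) (hi : Function.Injective i)
    (htf : ∀ p : ℕ, p.Prime → ∀ e : E, p • e ∈ i.range → e ∈ i.range) :
    ∃ r : E →+ G, ∀ g, r (i g) = g := by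
  have htf' : ∀ n : ℕ, n ≠ 0 → ∀ e : E, n • e ∈ i.range → e ∈ i.range := by
    intro n
    induction n using Nat.recOnMul with
    | zero => simp
    | one => simp
    | prime p hp => exact fun _ ↦ htf p hp
    | mul a b ha hb =>
      intro hab e he
      rw [mul_smul] at he
      exact hb (right_ne_zero_of_mul hab) e (ha (left_ne_zero_of_mul hab) _ he)
  have : IsAddTorsionFree (E ⧸ i.range) := by
    refine ⟨fun n hn x y hxy ↦ ?_⟩
    induction x using QuotientAddGroup.induction_on with | _ x
    induction y using QuotientAddGroup.induction_on with | _ y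
    simp only [← QuotientAddGroup.mk_nsmul] at hxy
    rw [QuotientAddGroup.eq] at hxy ⊢
    apply htf' n hn
    rwa [smul_add, smul_neg]
  obtain ⟨s, hs⟩ := hG E (E ⧸ i.range) i (QuotientAddGroup.mk' i.range) hi
    (fun x ↦ by simp [QuotientAddGroup.eq_zero_iff]) (QuotientAddGroup.mk'_surjective _)
  let f : E →+ i.range := (AddMonoidHom.id E - s.comp (QuotientAddGroup.mk' i.range)).codRestrict _
    (fun e ↦ by
      refine (QuotientAddGroup.eq_zero_iff _).1 ?_
      change QuotientAddGroup.mk' i.range _ = 0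
      have := DFunLike.congr_fun hs (QuotientAddGroup.mk' i.range e)
      simp only [AddMonoidHom.comp_apply, AddMonoidHom.id_apply] at this
      simp only [AddMonoidHom.sub_apply, AddMonoidHom.comp_apply, map_sub, AddMonoidHom.id_apply,
        this, sub_self])
  refine ⟨(AddMonoidHom.ofInjective hi).symm.toAddMonoidHom.comp f, fun g ↦ ?_⟩
  have : f (i g) = AddMonoidHom.ofInjective hi g := by
    ext
    have h0 : QuotientAddGroup.mk' i.range (i g) = 0 := by simp [QuotientAddGroup.eq_zero_iff]
    simp only [f, AddMonoidHom.codRestrict_apply, AddMonoidHom.sub_apply, AddMonoidHom.comp_apply,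
      h0, map_zero, AddMonoidHom.id_apply, sub_zero, AddMonoidHom.ofInjective_apply]
  simp [this]

/-! ### Completions of abelian groups at a prime -/

theorem mem_span_pow_smul_top {M : Type*} [AddCommGroup M] (p : ℤ) (n : ℕ) (x : M) :
    x ∈ (Ideal.span {p} ^ n • ⊤ : Submodule ℤ M) ↔ ∃ y, p ^ n • y = x := by
  rw [Ideal.span_singleton_pow, Submodule.ideal_span_singleton_smul,
    Submodule.mem_smul_pointwise_iff_exists]
  simp

theorem mem_span_smul_top {M : Type*} [AddCommGroup M] (p : ℤ) (x : M) :
    x ∈ (Ideal.span {p} • ⊤ : Submodule ℤ M) ↔ ∃ y, p • y = x := by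
  simpa using mem_span_pow_smul_top p 1 x

namespace AdicCompletion

variable {M N : Type*} [AddCommGroup M] [AddCommGroup N]

theorem ext_of_exists_smul {p : ℤ} {x : AdicCompletion (Ideal.span {p}) M}
    (h : ∀ n : ℕ, ∃ y, p ^ n • y = x) : x = 0 := by
  refine IsHausdorff.haus (I := Ideal.span {p}) inferInstance x fun n ↦ ?_
  rw [SModEq.zero, mem_span_pow_smul_top]
  exact h n

theorem exists_smul_eq_of_val_eq_zero {p : ℤ} {x : AdicCompletion (Ideal.span {p}) M} {n : ℕ}
    (h : x.val n = 0) : ∃ y, p ^ n • y = x := by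
  rw [← mem_span_pow_smul_top, pow_smul_top_eq_ker_eval ⟨{p}, by simp⟩]
  exact h

/-- By Bézout, multiplication by `q` is onto modulo `p`, and surjectivity modulo `p` passes to
completions. -/
theorem exists_smul_eq_of_isCoprime {p q : ℤ} (hpq : IsCoprime p q)
    (x : AdicCompletion (Ideal.span {p}) M) : ∃ y, q • y = x := by
  obtain ⟨a, b, hab⟩ := hpq
  let f : M →ₗ[ℤ] M := q • LinearMap.id
  have hs : Function.Surjective (map (Ideal.span {p}) f) := by
    apply map_surjective_of_mkQ_comp_surjective
    intro y
    obtain ⟨y, rfl⟩ := Submodule.mkQ_surjective _ y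
    refine ⟨b • y, ?_⟩
    rw [LinearMap.comp_apply, ← sub_eq_zero, ← map_sub]
    refine (Submodule.Quotient.mk_eq_zero _).2 ((mem_span_smul_top _ _).2 ⟨-a • y, ?_⟩)
    have : (a * p + b * q) • y = y := by rw [hab, one_smul]
    simp only [f, LinearMap.smul_apply, LinearMap.id_apply]
    nth_rw 3 [← this]
    module
  obtain ⟨y, rfl⟩ := hs x
  refine ⟨y, ?_⟩
  ext n
  obtain ⟨z, hz⟩ := Submodule.mkQ_surjective _ (y.val n)
  rw [map_val_apply, val_smul_apply, ← hz]
  rfl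

theorem eq_zero_of_smul_eq_zero_of_isCoprime {p q : ℤ} (hpq : IsCoprime p q)
    {x : AdicCompletion (Ideal.span {p}) M} (h : q • x = 0) : x = 0 := by
  ext n
  obtain ⟨a, b, hab⟩ := hpq.pow_left (m := n)
  have h1 : q • x.val n = 0 := by rw [← val_smul_apply, h, val_zero_apply]
  have h2 : p ^ n • x.val n = 0 := by
    obtain ⟨z, hz⟩ := Submodule.mkQ_surjective _ (x.val n)
    rw [← hz, ← map_smul]
    exact (Submodule.Quotient.mk_eq_zero _).2 ((mem_span_pow_smul_top _ _ _).2 ⟨z, rfl⟩)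
  rw [val_zero_apply, ← one_smul ℤ (x.val n), ← hab, add_smul, mul_smul, mul_smul, h1, h2]
  simp

theorem eq_zero_of_smul_eq_zero {p : ℤ} (hM : ∀ m : M, p • m = 0 → m = 0)
    {x : AdicCompletion (Ideal.span {p}) M} (h : p • x = 0) : x = 0 := by
  ext n
  -- Cancelling `p` costs one level, so vanishing at level `n` is read off from level `n + 1`.
  obtain ⟨z, hz⟩ := Submodule.mkQ_surjective _ (x.val (n + 1))
  have h1 : p • x.val (n + 1) = 0 := by rw [← val_smul_apply, h, val_zero_apply]
  rw [← hz, ← map_smul] at h1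
  obtain ⟨w, hw⟩ := (mem_span_pow_smul_top _ _ _).1 ((Submodule.Quotient.mk_eq_zero _).1 h1)
  have hzw : p ^ n • w = z := by
    rw [← sub_eq_zero]
    apply hM
    rw [smul_sub, ← hw, pow_succ', mul_smul, sub_self]
  rw [val_zero_apply]
  refine (x.2 (Nat.le_succ n)).symm.trans ?_
  change transitionMap _ _ _ (x.val (n + 1)) = 0
  rw [← hz]
  exact (Submodule.Quotient.mk_eq_zero _).2 ((mem_span_pow_smul_top _ _ _).2 ⟨w, hzw⟩)

/-- The last two hypotheses say that `f` is an isomorphism modulo `p`. Without `p`-torsion in `N`,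
injectivity climbs to every `p ^ n`. -/
theorem map_bijective {p : ℤ} (f : M →ₗ[ℤ] N) (hN : ∀ y : N, p • y = 0 → y = 0)
    (hsurj : ∀ y, ∃ x z, y = f x + p • z) (hinj : ∀ x z, f x = p • z → ∃ x', x = p • x') :
    Function.Bijective (map (Ideal.span {p}) f) := by
  constructor
  · have key : ∀ (n : ℕ) x z, f x = p ^ n • z → ∃ x', x = p ^ n • x' := by
      intro n
      induction n with
      | zero => exact fun x _ _ ↦ ⟨x, by simp⟩
      | succ n ih =>
        intro x z hx
        obtain ⟨x', rfl⟩ := hinj x (p ^ n • z) (by rw [hx, pow_succ', mul_smul])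
        obtain ⟨w, rfl⟩ := ih x' z <| by
          rw [← sub_eq_zero]
          apply hN
          rw [smul_sub, ← map_smul, hx, pow_succ', mul_smul, sub_self]
        exact ⟨w, by rw [pow_succ', mul_smul]⟩
    rw [injective_iff_map_eq_zero]
    intro x hx
    ext n
    obtain ⟨z, hz⟩ := Submodule.mkQ_surjective _ (x.val n)
    have h1 : (map (Ideal.span {p}) f x).val n = 0 := by rw [hx, val_zero_apply]
    rw [map_val_apply, ← hz] at h1
    obtain ⟨w, hw⟩ := (mem_span_pow_smul_top _ _ _).1 ((Submodule.Quotient.mk_eq_zero _).1 h1)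
    obtain ⟨v, rfl⟩ := key n z w hw.symm
    rw [← hz]
    exact (Submodule.Quotient.mk_eq_zero _).2 ((mem_span_pow_smul_top _ _ _).2 ⟨v, rfl⟩)
  · apply map_surjective_of_mkQ_comp_surjective
    intro y
    obtain ⟨y, rfl⟩ := Submodule.mkQ_surjective _ y
    obtain ⟨x, z, rfl⟩ := hsurj y
    refine ⟨x, ?_⟩
    rw [LinearMap.comp_apply, ← sub_eq_zero, ← map_sub]
    exact (Submodule.Quotient.mk_eq_zero _).2 ((mem_span_smul_top _ _).2 ⟨-z, by simp⟩)

end AdicCompletion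

/-! ### Failure of the Hopfian property in infinite rank -/

theorem not_isHopfianGroup_adicCompletion_finsupp {B : Type*} [Infinite B] {p : ℕ} (hp : p.Prime) :
    ¬ IsHopfianGroup (AdicCompletion (Ideal.span {(p : ℤ)}) (B →₀ ℤ)) := by
  intro h
  obtain ⟨s, hs, a, b, hab, hsab⟩ := exists_surjective_not_injective B
  let φ : (B →₀ ℤ) →ₗ[ℤ] (B →₀ ℤ) := Finsupp.lmapDomain ℤ ℤ s
  have hφ : Function.Surjective φ := Finsupp.mapDomain_surjective hs
  let I : Ideal ℤ := Ideal.span {(p : ℤ)}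
  let Φ : AdicCompletion I (B →₀ ℤ) →+ AdicCompletion I (B →₀ ℤ) :=
    (AdicCompletion.map I φ).toAddMonoidHom
  have hinj := (h Φ (AdicCompletion.map_surjective I hφ)).1
  have heq : AdicCompletion.of I (B →₀ ℤ) (.single a 1) = AdicCompletion.of I _ (.single b 1) := by
    apply hinj
    change AdicCompletion.map I φ _ = AdicCompletion.map I φ _
    rw [AdicCompletion.map_of, AdicCompletion.map_of]
    simp [φ, hsab]
  have h1 := congrArg (fun x ↦ x.val 1) heq
  simp only [AdicCompletion.of_apply] at h1
  rw [← sub_eq_zero, ← map_sub] at h1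
  obtain ⟨w, hw⟩ := (mem_span_pow_smul_top _ _ _).1 ((Submodule.Quotient.mk_eq_zero _).1 h1)
  have h2 := DFunLike.congr_fun hw a
  simp only [pow_one, Finsupp.smul_apply, smul_eq_mul, Finsupp.sub_apply, Finsupp.single_eq_same,
    Finsupp.single_eq_of_ne hab, sub_zero] at h2
  exact hp.one_lt.ne' (by exact_mod_cast Int.eq_one_of_dvd_one (by positivity) ⟨_, h2.symm⟩)

theorem not_isHopfianGroup_finsupp {B : Type*} [Infinite B] : ¬ IsHopfianGroup (B →₀ ℚ) := by
  intro h
  obtain ⟨s, hs, a, b, hab, hsab⟩ := exists_surjective_not_injective B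
  have hinj := (h (Finsupp.mapDomain.addMonoidHom s) (Finsupp.mapDomain_surjective hs)).1
  have : Finsupp.single a (1 : ℚ) = Finsupp.single b 1 := hinj (by simp [hsab])
  exact hab (Finsupp.single_left_injective one_ne_zero this)

/-- The maximal divisible subgroup of a torsion-free abelian group: the elements divisible by every
nonzero integer. -/
def divisiblePart (G : Type*) [AddCommGroup G] : AddSubgroup G where
  carrier := {x | ∀ n : ℤ, n ≠ 0 → ∃ y, n • y = x}
  zero_mem' := fun n _ ↦ ⟨0, smul_zero n⟩
  add_mem' := fun {a b} ha hb n hn ↦ by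
    obtain ⟨x, rfl⟩ := ha n hn
    obtain ⟨y, rfl⟩ := hb n hn
    exact ⟨x + y, smul_add _ _ _⟩
  neg_mem' := fun {a} ha n hn ↦ by
    obtain ⟨x, rfl⟩ := ha n hn
    exact ⟨-x, smul_neg _ _⟩

/-! ### Structure of torsion-free cotorsion groups -/

section TorsionFree

variable {G : Type u} [AddCommGroup G] [IsAddTorsionFree G]

theorem divisiblePart_smul_surjective {n : ℤ} (hn : n ≠ 0) :
    Function.Surjective fun x : divisiblePart G ↦ n • x := by
  rintro ⟨x, hx⟩
  obtain ⟨y, rfl⟩ := hx n hn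
  refine ⟨⟨y, fun m hm ↦ ?_⟩, rfl⟩
  obtain ⟨z, hz⟩ := hx (n * m) (mul_ne_zero hn hm)
  refine ⟨z, zsmul_right_injective hn ?_⟩
  simpa only [mul_smul] using hz

theorem exists_divisiblePart_retraction :
    ∃ r : G →+ divisiblePart G, ∀ x : divisiblePart G, r x = x := by
  let : DivisibleBy (divisiblePart G) ℤ :=
    divisibleByOfSMulRightSurj _ _ fun {n} hn ↦ divisiblePart_smul_surjective hn
  obtain ⟨r, hr⟩ := Module.Baer.extension_property_addMonoidHom
    (Module.Baer.of_divisible (divisiblePart G)) (divisiblePart G).subtype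
    Subtype.val_injective (AddMonoidHom.id _)
  exact ⟨r, fun x ↦ DFunLike.congr_fun hr x⟩

/-- Such a group equals its divisible hull, a rational vector space. -/
theorem exists_addEquiv_finsupp_rat
    (h : ∀ n : ℤ, n ≠ 0 → Function.Surjective fun x : G ↦ n • x) :
    ∃ B : Type u, Nonempty (G ≃+ (B →₀ ℚ)) := by
  have hb : Function.Bijective (DivisibleHull.coeAddMonoidHom G) := by
    refine ⟨DivisibleHull.coe_injective, fun x ↦ ?_⟩
    induction x using DivisibleHull.ind with | _ m s
    obtain ⟨y, rfl⟩ := h (s : ℕ) (by simp) m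
    refine ⟨y, ?_⟩
    change DivisibleHull.mk y 1 = DivisibleHull.mk _ s
    rw [DivisibleHull.mk_eq_mk_iff_smul_eq_smul]
    simp
  let b := Module.Basis.ofVectorSpace ℚ (DivisibleHull G)
  exact ⟨_, ⟨(AddEquiv.ofBijective _ hb).trans b.repr.toAddEquiv⟩⟩

variable (G) in
-- The natural map `i` is injective with torsion-free cokernel, so it splits. The cokernel is also
-- divisible, and the kernel of the retraction, a copy of it, must then vanish.
theorem IsCotorsionGroup.exists_addEquiv_prod_pi (hG : IsCotorsionGroup G) :
    Nonempty (G ≃+ divisiblePart G ×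
      ((p : Nat.Primes) → AdicCompletion (Ideal.span {((p : ℕ) : ℤ)}) G)) := by
  obtain ⟨ρ, hρ⟩ := exists_divisiblePart_retraction (G := G)
  let i : G →+ divisiblePart G ×
      ((p : Nat.Primes) → AdicCompletion (Ideal.span {((p : ℕ) : ℤ)}) G) :=
    ρ.prod (AddMonoidHom.mk' (fun g p ↦ AdicCompletion.of _ G g) fun a b ↦ by ext; simp)
  have hi1 : ∀ g, (i g).1 = ρ g := fun g ↦ rfl
  have hi2 : ∀ g p, (i g).2 p = AdicCompletion.of _ G g := fun g p ↦ rfl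
  have hdvd : ∀ (p : Nat.Primes) (n : ℕ) (g : G),
      ((i g).2 p).val n = 0 → ∃ y, ((p : ℕ) : ℤ) ^ n • y = g := by
    intro p n g h
    exact (mem_span_pow_smul_top _ _ _).1 ((Submodule.Quotient.mk_eq_zero _).1 h)
  have hcop : ∀ p q : Nat.Primes, p ≠ q → IsCoprime ((p : ℕ) : ℤ) ((q : ℕ) : ℤ) := by
    intro p q hpq
    rw [Nat.isCoprime_iff_coprime]
    exact (Nat.coprime_primes p.2 q.2).2 fun h ↦ hpq (Subtype.ext h)
  have hker : ∀ g : G, (i g).2 = 0 → g ∈ divisiblePart G := by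
    intro g hg
    have hpow : ∀ (p : ℕ) (_ : p.Prime) (n : ℕ), ∃ y, (p : ℤ) ^ n • y = g := by
      intro p hp n
      apply hdvd ⟨p, hp⟩
      rw [hg]
      rfl
    have hnat : ∀ n : ℕ, n ≠ 0 → ∃ y : G, n • y = g := by
      intro n
      induction n using Nat.recOnPosPrimePosCoprime with
      | zero => simp
      | one => exact fun _ ↦ ⟨g, one_smul _ _⟩
      | prime_pow p n hp hn =>
        intro _
        obtain ⟨y, hy⟩ := hpow p hp n
        exact ⟨y, by rw [← hy, ← Nat.cast_pow, natCast_zsmul]⟩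
      | coprime a b ha hb hab iha ihb =>
        intro _
        obtain ⟨x, hx⟩ := iha (by omega)
        obtain ⟨y, hy⟩ := ihb (by omega)
        obtain ⟨u, v, huv⟩ := Nat.isCoprime_iff_coprime.2 hab
        refine ⟨u • y + v • x, ?_⟩
        rw [← natCast_zsmul] at hx hy ⊢
        have : (u * a + v * b) • g = g := by rw [huv, one_smul]
        calc ((a * b : ℕ) : ℤ) • (u • y + v • x)
            = (u * a) • ((b : ℤ) • y) + (v * b) • ((a : ℤ) • x) := by push_cast; module
          _ = g := by rw [hx, hy, ← add_smul, this]
    intro n hn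
    obtain ⟨y, hy⟩ := hnat n.natAbs (by simpa)
    rcases Int.natAbs_eq n with h | h
    · exact ⟨y, by rw [h, natCast_zsmul, hy]⟩
    · exact ⟨-y, by rw [h, neg_smul_neg, natCast_zsmul, hy]⟩
  have hinj : Function.Injective i := by
    rw [injective_iff_map_eq_zero]
    intro g hg
    have h1 := hρ ⟨g, hker g (by rw [hg]; rfl)⟩
    have h2 : ρ g = 0 := by rw [← hi1, hg]; rfl
    simpa using congrArg Subtype.val (h1.symm.trans h2)
  have htf : ∀ (p : ℕ) (_ : p.Prime) (e : divisiblePart G ×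
      ((p : Nat.Primes) → AdicCompletion (Ideal.span {((p : ℕ) : ℤ)}) G)),
      p • e = 0 → e = 0 := by
    intro p hp e he
    ext1
    · have : p • e.1 = 0 := congrArg Prod.fst he
      exact (smul_eq_zero_iff_right hp.ne_zero).1 this
    · ext1 q
      have hq : (p : ℤ) • e.2 q = 0 := by
        rw [natCast_zsmul]
        exact congrFun (congrArg Prod.snd he) q
      by_cases hpq : (⟨p, hp⟩ : Nat.Primes) = q
      · subst hpq
        refine AdicCompletion.eq_zero_of_smul_eq_zero (fun m hm ↦ ?_) hq
        exact (smul_eq_zero_iff_right (by exact_mod_cast hp.ne_zero)).1 hm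
      · exact AdicCompletion.eq_zero_of_smul_eq_zero_of_isCoprime (hcop _ _ (Ne.symm hpq)) hq
  obtain ⟨r, hr⟩ := hG.exists_retraction i hinj (by
    rintro p hp e ⟨g, hg⟩
    obtain ⟨y, rfl⟩ := hdvd ⟨p, hp⟩ 1 g (by
      rw [hg]
      change ((p • e.2 ⟨p, hp⟩).val 1) = 0
      rw [AdicCompletion.val_smul_apply]
      obtain ⟨z, hz⟩ := Submodule.mkQ_surjective _ ((e.2 ⟨p, hp⟩).val 1)
      rw [← hz, ← map_nsmul]
      exact (Submodule.Quotient.mk_eq_zero _).2 ((mem_span_pow_smul_top _ _ _).2 ⟨z, by simp⟩))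
    refine ⟨y, ?_⟩
    rw [← sub_eq_zero]
    apply htf p hp
    rw [smul_sub, ← hg, ← map_nsmul]
    simp)
  -- The cokernel of `i` is `p`-divisible: `g` matches `e` modulo `p` in the factor at `p`, and
  -- multiplication by `p` is onto in all other factors.
  have hdiv : ∀ (p : ℕ) (_ : p.Prime) (e : divisiblePart G ×
      ((p : Nat.Primes) → AdicCompletion (Ideal.span {((p : ℕ) : ℤ)}) G)),
      ∃ g y, e = i g + p • y := by
    intro p hp e
    obtain ⟨g, hg⟩ := Submodule.mkQ_surjective _ ((e.2 ⟨p, hp⟩).val 1)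
    obtain ⟨d, hd⟩ := divisiblePart_smul_surjective (G := G) (n := p)
      (by exact_mod_cast hp.ne_zero) (e.1 - ρ g)
    have h2 : ∀ q : Nat.Primes, ∃ y, p • y = e.2 q - (i g).2 q := by
      intro q
      by_cases hpq : (⟨p, hp⟩ : Nat.Primes) = q
      · subst hpq
        obtain ⟨y, hy⟩ := AdicCompletion.exists_smul_eq_of_val_eq_zero (n := 1)
          (x := e.2 ⟨p, hp⟩ - (i g).2 ⟨p, hp⟩) (by
            rw [AdicCompletion.val_sub_apply, ← hg]
            exact sub_self _)
        exact ⟨y, by rw [← hy, pow_one, natCast_zsmul]⟩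
      · obtain ⟨y, hy⟩ := AdicCompletion.exists_smul_eq_of_isCoprime (hcop q ⟨p, hp⟩ (Ne.symm hpq))
          (e.2 q - (i g).2 q)
        exact ⟨y, by rw [← hy, natCast_zsmul]⟩
    choose y hy using h2
    refine ⟨g, (d, y), ?_⟩
    rw [← sub_eq_iff_eq_add']
    ext1
    · exact (by simpa using hd.symm : e.1 - ρ g = p • d)
    · ext1 q
      exact (hy q).symm
  have hkerdiv : ∀ (p : ℕ) (_ : p.Prime) (n : ℕ) e, r e = 0 → ∃ y, r y = 0 ∧ p ^ n • y = e := by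
    intro p hp n
    induction n with
    | zero => exact fun e he ↦ ⟨e, he, by simp⟩
    | succ n ih =>
      intro e he
      obtain ⟨x, hx, rfl⟩ := ih e he
      obtain ⟨g, y, rfl⟩ := hdiv p hp x
      have hg : g = -(p • r y) := by
        rwa [map_add, hr, map_nsmul, ← eq_neg_iff_add_eq_zero] at hx
      refine ⟨y - i (r y), by rw [map_sub, hr, sub_self], ?_⟩
      rw [hg, map_neg, map_nsmul, pow_succ, mul_smul, smul_sub, neg_add_eq_sub]
  have hrinj : Function.Injective r := by
    rw [injective_iff_map_eq_zero]
    intro e he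
    have h2 : e.2 = 0 := by
      ext1 p
      refine AdicCompletion.ext_of_exists_smul fun n ↦ ?_
      obtain ⟨y, -, rfl⟩ := hkerdiv p p.2 n e he
      refine ⟨y.2 p, ?_⟩
      rw [← Nat.cast_pow, natCast_zsmul]
      rfl
    -- Divisible elements die in every completion, so `i` sends `e.1` to `(e.1, 0)`.
    have h1 : i e.1 = e := by
      ext1
      · rw [hi1, hρ]
      · rw [h2]
        ext1 p
        refine AdicCompletion.ext_of_exists_smul fun n ↦ ?_
        obtain ⟨y, hy⟩ := divisiblePart_smul_surjective (G := G) (n := ((p : ℕ) : ℤ) ^ n)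
          (pow_ne_zero _ (by exact_mod_cast p.2.ne_zero)) e.1
        refine ⟨AdicCompletion.of _ _ (y : G), ?_⟩
        rw [hi2, ← map_smul, ← hy]
        rfl
    rw [← h1, hr] at he
    rw [← h1, he, map_zero]
  exact ⟨(AddEquiv.ofBijective r ⟨hrinj, fun g ↦ ⟨i g, hr g⟩⟩).symm⟩

end TorsionFree

/-! ### Completions as powers of the `p`-adic integers -/

/-- `ℤ_[p]^k` is the `p`-adic completion of `ℤ^k`. -/
theorem nonempty_adicCompletion_pi_addEquiv (p : ℕ) [hp : Fact p.Prime] (k : ℕ) :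
    Nonempty (AdicCompletion (Ideal.span {(p : ℤ)}) (Fin k → ℤ) ≃+ (Fin k → ℤ_[p])) := by
  let I : Ideal ℤ := Ideal.span {(p : ℤ)}
  have hc : IsAdicComplete I ℤ_[p] := by
    rw [← IsAdicComplete.map_algebraMap_iff (S := ℤ_[p])]
    have : I.map (algebraMap ℤ ℤ_[p]) = IsLocalRing.maximalIdeal ℤ_[p] := by
      rw [PadicInt.maximalIdeal_eq_span_p, Ideal.map_span, Set.image_singleton]
      simp
    rw [this]
    infer_instance
  have hp0 : (p : ℤ_[p]) ≠ 0 := by exact_mod_cast hp.out.ne_zero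
  have hb : Function.Bijective (AdicCompletion.map I (Algebra.linearMap ℤ ℤ_[p])) := by
    apply AdicCompletion.map_bijective
    · intro y hy
      simpa [hp0] using hy
    · intro y
      obtain ⟨z, hz⟩ := Ideal.mem_span_singleton.1 (PadicInt.appr_spec 1 y)
      refine ⟨y.appr 1, z, ?_⟩
      rw [pow_one, sub_eq_iff_eq_add] at hz
      simp only [Algebra.linearMap_apply, zsmul_eq_mul, eq_intCast, Int.cast_natCast]
      linear_combination hz
    · intro x z hx
      have : (p : ℤ) ∣ x := by
        rw [← PadicInt.norm_int_lt_one_iff_dvd, PadicInt.norm_lt_one_iff_dvd]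
        exact ⟨z, by simpa using hx⟩
      obtain ⟨w, rfl⟩ := this
      exact ⟨w, rfl⟩
  exact ⟨(AdicCompletion.piEquivOfFintype I fun _ : Fin k ↦ ℤ).toAddEquiv.trans
    (AddEquiv.piCongrRight fun _ ↦ (AddEquiv.ofBijective _ hb).trans
      (AdicCompletion.ofLinearEquiv I ℤ_[p]).symm.toAddEquiv)⟩

/-- Here `V` plays the role of `G/pG`. Lifting a basis of it to `G` gives a map from a free group
that is an isomorphism modulo `p`. -/
theorem exists_adicCompletion_addEquiv_finsupp_of_quotient {G V : Type u} [AddCommGroup G]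
    [IsAddTorsionFree G] (p : ℕ) [hp : Fact p.Prime] [AddCommGroup V] [Module (ZMod p) V]
    (π : G →ₗ[ℤ] V) (hπ : Function.Surjective π) (hker : ∀ x, π x = 0 ↔ ∃ y, (p : ℤ) • y = x) :
    ∃ B : Type u, Nonempty (AdicCompletion (Ideal.span {(p : ℤ)}) (B →₀ ℤ) ≃+
      AdicCompletion (Ideal.span {(p : ℤ)}) G) := by
  let b := Module.Basis.ofVectorSpace (ZMod p) V
  choose e he using fun i ↦ hπ (b i)
  let f := Finsupp.linearCombination ℤ e
  have hf : ∀ x, π (f x) = Finsupp.linearCombination (ZMod p) b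
      (x.mapRange (Int.cast : ℤ → ZMod p) Int.cast_zero) := by
    intro x
    induction x using Finsupp.induction_linear with
    | zero => simp
    | add x y hx hy =>
      rw [map_add, map_add, hx, hy, ← map_add, Finsupp.mapRange_add (by simp)]
    | single i a => simp [f, he, Int.cast_smul_eq_zsmul]
  have hb := AdicCompletion.map_bijective (p := (p : ℤ)) f
    (fun y hy ↦ (smul_eq_zero_iff_right (by exact_mod_cast hp.out.ne_zero)).1 hy)
    (by
      intro y
      let c := b.repr (π y)
      let x : _ →₀ ℤ := c.mapRange (fun a ↦ (a.val : ℤ)) (by simp)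
      have hx : x.mapRange (Int.cast : ℤ → ZMod p) Int.cast_zero = c := by
        ext i
        simp [x]
      have h : π (y - f x) = 0 := by
        rw [map_sub, hf, hx, b.linearCombination_repr, sub_self]
      obtain ⟨z, hz⟩ := (hker _).1 h
      exact ⟨x, z, by rw [hz]; abel⟩)
    (by
      intro x z hx
      have h : π (f x) = 0 := by
        rw [hx]
        exact (hker _).2 ⟨z, rfl⟩
      rw [hf] at h
      have h0 := linearIndependent_iff.1 b.linearIndependent _ h
      have hd : ∀ i, (p : ℤ) ∣ x i := fun i ↦ by
        rw [← ZMod.intCast_zmod_eq_zero_iff_dvd]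
        simpa using DFunLike.congr_fun h0 i
      refine ⟨x.mapRange (· / p) (by simp), ?_⟩
      ext i
      simp [Int.mul_ediv_cancel' (hd i)])
  exact ⟨_, ⟨AddEquiv.ofBijective _ hb⟩⟩

theorem exists_adicCompletion_addEquiv_finsupp (G : Type u) [AddCommGroup G] [IsAddTorsionFree G]
    (p : ℕ) [hp : Fact p.Prime] :
    ∃ B : Type u, Nonempty (AdicCompletion (Ideal.span {(p : ℤ)}) (B →₀ ℤ) ≃+
      AdicCompletion (Ideal.span {(p : ℤ)}) G) := by
  let S : Submodule ℤ G := Ideal.span {(p : ℤ)} • ⊤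
  have hS : ∀ x, S.mkQ x = 0 ↔ ∃ y, (p : ℤ) • y = x := fun x ↦
    (Submodule.Quotient.mk_eq_zero _).trans (mem_span_smul_top _ _)
  let : Module (ZMod p) (G ⧸ S) := AddCommGroup.zmodModule fun x ↦ by
    obtain ⟨x, rfl⟩ := Submodule.mkQ_surjective _ x
    rw [← map_nsmul]
    exact (hS _).2 ⟨x, natCast_zsmul _ _⟩
  exact exists_adicCompletion_addEquiv_finsupp_of_quotient p S.mkQ S.mkQ_surjective hS

theorem IsHopfianGroup.exists_adicCompletion_addEquiv {G : Type u} [AddCommGroup G]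
    [IsAddTorsionFree G] (p : ℕ) [hp : Fact p.Prime]
    (h : IsHopfianGroup (AdicCompletion (Ideal.span {(p : ℤ)}) G)) :
    ∃ k : ℕ, Nonempty (AdicCompletion (Ideal.span {(p : ℤ)}) G ≃+ (Fin k → ℤ_[p])) := by
  obtain ⟨B, ⟨e⟩⟩ := exists_adicCompletion_addEquiv_finsupp G p
  have hB : Finite B := by
    by_contra hB
    rw [not_finite_iff_infinite] at hB
    exact not_isHopfianGroup_adicCompletion_finsupp hp.out
      (h.of_retract e.toAddMonoidHom e.symm.toAddMonoidHom e.symm_apply_apply)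
  obtain ⟨k, ⟨σ⟩⟩ := Finite.exists_equiv_fin B
  obtain ⟨e'⟩ := nonempty_adicCompletion_pi_addEquiv p k
  exact ⟨k, ⟨(e.symm.trans (AdicCompletion.congr _ ((Finsupp.domLCongr σ).trans
    (Finsupp.linearEquivFunOnFinite ℤ ℤ (Fin k)))).toAddEquiv).trans e'⟩⟩

theorem IsCotorsionGroup.exists_addEquiv_of_isHopfianGroup {G : Type u} [AddCommGroup G]
    [IsAddTorsionFree G] (hG : IsCotorsionGroup G) (h : IsHopfianGroup G) :
    ∃ (n : ℕ) (k : Nat.Primes → ℕ),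
      Nonempty (G ≃+ (Fin n → ℚ) × ((p : Nat.Primes) → (Fin (k p) → ℤ_[p]))) := by
  obtain ⟨e⟩ := hG.exists_addEquiv_prod_pi G
  have h' := h.of_retract e.symm.toAddMonoidHom e.toAddMonoidHom e.apply_symm_apply
  obtain ⟨B, ⟨eB⟩⟩ := exists_addEquiv_finsupp_rat (G := divisiblePart G)
    fun n hn ↦ divisiblePart_smul_surjective hn
  have hD : IsHopfianGroup (divisiblePart G) :=
    h'.of_retract (AddMonoidHom.inl _ _) (AddMonoidHom.fst _ _) fun _ ↦ rfl
  have hB : Finite B := by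
    by_contra hB
    rw [not_finite_iff_infinite] at hB
    exact not_isHopfianGroup_finsupp
      (hD.of_retract eB.symm.toAddMonoidHom eB.toAddMonoidHom eB.apply_symm_apply)
  obtain ⟨n, ⟨σ⟩⟩ := Finite.exists_equiv_fin B
  classical
  have hk (p : Nat.Primes) := IsHopfianGroup.exists_adicCompletion_addEquiv (G := G) p <|
    h'.of_retract ((AddMonoidHom.inr _ _).comp (AddMonoidHom.single
      (fun p : Nat.Primes ↦ AdicCompletion (Ideal.span {((p : ℕ) : ℤ)}) G) p))
      ((Pi.evalAddMonoidHom _ p).comp (AddMonoidHom.snd _ _)) fun x ↦ by simp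
  choose k hk using hk
  exact ⟨n, k, ⟨e.trans (((eB.trans ((Finsupp.domLCongr σ).trans
    (Finsupp.linearEquivFunOnFinite ℚ ℚ (Fin n))).toAddEquiv)).prodCongr
      (AddEquiv.piCongrRight fun p ↦ (hk p).some))⟩⟩

/-! ### Endomorphisms with finite cokernel -/

theorem AddCommGroup.exists_forall_nsmul_mem_range {G : Type*} [AddCommGroup G] (φ : G →+ G)
    (h : Finite (G ⧸ φ.range)) : ∃ m : ℕ, m ≠ 0 ∧ ∀ x, ∃ g, φ g = m • x :=
  ⟨φ.range.index, AddSubgroup.index_ne_zero_of_finite, fun x ↦ φ.range.nsmul_index_mem x⟩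

namespace PadicInt

variable {p : ℕ} [hp : Fact p.Prime]

theorem eq_zero_of_forall_pow_dvd {x : ℤ_[p]} (h : ∀ n : ℕ, (p : ℤ_[p]) ^ n ∣ x) : x = 0 := by
  refine IsHausdorff.haus (I := IsLocalRing.maximalIdeal ℤ_[p]) inferInstance x fun n ↦ ?_
  rw [SModEq.zero, maximalIdeal_eq_span_p, Ideal.span_singleton_pow, smul_eq_mul, Ideal.mul_top,
    Ideal.mem_span_singleton]
  exact h n

theorem isUnit_prime_of_ne {q : ℕ} (hq : q.Prime) (hqp : q ≠ p) : IsUnit (q : ℤ_[p]) := by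
  rw [isUnit_iff, norm_natCast_eq_one_iff]
  exact (Nat.coprime_primes hp.out hq).2 hqp.symm

/-- Additivity gives linearity over natural numbers; approximating `z` by them modulo `p ^ n` leaves
an error divisible by every `p ^ n`. -/
theorem map_smul_of_addMonoidHom {ι κ : Type*} (f : (ι → ℤ_[p]) →+ (κ → ℤ_[p])) (z : ℤ_[p])
    (v : ι → ℤ_[p]) : f (z • v) = z • f v := by
  ext i
  rw [← sub_eq_zero]
  refine eq_zero_of_forall_pow_dvd fun n ↦ ?_
  obtain ⟨w, hw⟩ := Ideal.mem_span_singleton.1 (appr_spec n z)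
  have hz : z = z.appr n + p ^ n * w := by rw [← hw]; ring
  have h1 : z • v = z.appr n • v + p ^ n • (w • v) := by
    ext j
    simp only [← Nat.cast_smul_eq_nsmul ℤ_[p], Pi.smul_apply, Pi.add_apply, smul_eq_mul,
      Nat.cast_pow]
    linear_combination v j * hz
  refine ⟨f (w • v) i - w * f v i, ?_⟩
  rw [h1, map_add, map_nsmul, map_nsmul]
  simp only [← Nat.cast_smul_eq_nsmul ℤ_[p], Pi.smul_apply, Pi.add_apply, smul_eq_mul,
    Nat.cast_pow]
  linear_combination -(f v i) * hz

/-- Multiplication by `m` factors through `f`, so `det f` divides a power of `m` and is nonzero. -/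
theorem injective_of_forall_nsmul_mem_range {ι : Type*} [Finite ι]
    (f : (ι → ℤ_[p]) →+ (ι → ℤ_[p])) {m : ℕ} (hm : m ≠ 0) (h : ∀ x, ∃ y, f y = m • x) :
    Function.Injective f := by
  classical
  have := Fintype.ofFinite ι
  let L : (ι → ℤ_[p]) →ₗ[ℤ_[p]] (ι → ℤ_[p]) := { f with map_smul' := map_smul_of_addMonoidHom f }
  let b := Pi.basisFun ℤ_[p] ι
  choose y hy using fun i ↦ h (b i)
  let g := b.constr ℤ_[p] y
  have hLg : L ∘ₗ g = (m : ℤ_[p]) • LinearMap.id := by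
    refine b.ext fun i ↦ ?_
    rw [LinearMap.comp_apply, b.constr_basis]
    exact (hy i).trans (Nat.cast_smul_eq_nsmul ℤ_[p] m (b i)).symm
  have hdet : LinearMap.det L ≠ 0 := by
    intro h0
    have := congrArg LinearMap.det hLg
    rw [LinearMap.det_comp, h0, zero_mul, LinearMap.det_smul, LinearMap.det_id, mul_one] at this
    exact pow_ne_zero _ (Nat.cast_ne_zero.2 hm) this.symm
  rw [injective_iff_map_eq_zero]
  intro x hx
  rw [← LinearMap.det_toMatrix'] at hdet
  refine Matrix.eq_zero_of_mulVec_eq_zero hdet ?_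
  rw [← Matrix.toLin'_apply, Matrix.toLin'_toMatrix']
  exact hx

end PadicInt

theorem isCofinitelyInjective_rat_prod_padicInt (n : ℕ) (k : Nat.Primes → ℕ) :
    IsCofinitelyInjective ((Fin n → ℚ) × ((p : Nat.Primes) → (Fin (k p) → ℤ_[p]))) := by
  intro φ hφ
  obtain ⟨m, hm, hφm⟩ := AddCommGroup.exists_forall_nsmul_mem_range φ hφ
  -- Such an `x` is divisible by every `p ^ N`, since `p` is invertible in all the other factors.
  have hzero : ∀ (p : Nat.Primes) x, x.2 p = 0 → (φ x).2 p = 0 := by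
    intro p x hx
    ext i
    refine PadicInt.eq_zero_of_forall_pow_dvd fun N ↦ ?_
    have hex : ∀ q, ∃ y : Fin (k q) → ℤ_[q], (p : ℕ) ^ N • y = x.2 q := by
      intro q
      by_cases hpq : p = q
      · subst hpq
        exact ⟨0, by rw [hx, smul_zero]⟩
      · obtain ⟨u, hu⟩ := PadicInt.isUnit_prime_of_ne (p := q) p.2 fun h ↦ hpq (Subtype.ext h)
        refine ⟨(↑(u⁻¹) : ℤ_[q]) ^ N • x.2 q, ?_⟩
        rw [← Nat.cast_smul_eq_nsmul ℤ_[q], smul_smul, Nat.cast_pow, ← hu, ← mul_pow,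
          Units.mul_inv, one_pow, one_smul]
    choose y hy using hex
    have hxy : x = (p : ℕ) ^ N • (((p : ℚ) ^ N)⁻¹ • x.1, y) := by
      ext1
      · change x.1 = (p : ℕ) ^ N • (((p : ℚ) ^ N)⁻¹ • x.1)
        rw [← Nat.cast_smul_eq_nsmul ℚ, smul_smul, Nat.cast_pow, mul_inv_cancel₀, one_smul]
        exact pow_ne_zero _ (Nat.cast_ne_zero.2 p.2.ne_zero)
      · ext1 q
        exact (hy q).symm
    rw [hxy, map_nsmul]
    refine ⟨(φ (((p : ℚ) ^ N)⁻¹ • x.1, y)).2 p i, ?_⟩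
    simp
  classical
  have hcomp : ∀ (p : Nat.Primes) x, (φ x).2 p = 0 → x.2 p = 0 := by
    intro p
    let f : (Fin (k p) → ℤ_[p]) →+ (Fin (k p) → ℤ_[p]) :=
      ((Pi.evalAddMonoidHom _ p).comp (AddMonoidHom.snd _ _)).comp
        (φ.comp ((AddMonoidHom.inr _ _).comp (AddMonoidHom.single _ p)))
    have hf : ∀ x, f (x.2 p) = (φ x).2 p := by
      intro x
      have := hzero p (x - (0, Pi.single p (x.2 p))) (by simp)
      rw [map_sub] at this
      exact (sub_eq_zero.1 this).symm
    have hinj : Function.Injective f := by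
      refine PadicInt.injective_of_forall_nsmul_mem_range f hm fun v ↦ ?_
      obtain ⟨g, hg⟩ := hφm (0, Pi.single p v)
      refine ⟨g.2 p, ?_⟩
      rw [hf, hg]
      simp
    intro x hx
    exact hinj (by rw [hf, hx, map_zero])
  let ψ : (Fin n → ℚ) →ₗ[ℚ] (Fin n → ℚ) :=
    ((AddMonoidHom.fst _ _).comp (φ.comp (AddMonoidHom.inl _ _))).toRatLinearMap
  have hψ : ∀ x : (Fin n → ℚ) × ((p : Nat.Primes) → (Fin (k p) → ℤ_[p])),
      x.2 = 0 → ψ x.1 = (φ x).1 := by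
    rintro ⟨a, b⟩ rfl
    rfl
  have hsurj : Function.Surjective ψ := by
    intro d
    obtain ⟨g, hg⟩ := hφm ((m : ℚ)⁻¹ • d, 0)
    refine ⟨g.1, ?_⟩
    -- The preimage `g` has no `p`-adic components, because its image has none.
    rw [hψ g (funext fun p ↦ hcomp p g (by rw [hg]; simp)), hg]
    change m • ((m : ℚ)⁻¹ • d) = d
    rw [← Nat.cast_smul_eq_nsmul ℚ, smul_smul, mul_inv_cancel₀ (Nat.cast_ne_zero.2 hm), one_smul]
  have hinj := LinearMap.injective_iff_surjective.2 hsurj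
  rw [injective_iff_map_eq_zero]
  intro x hx
  have h2 : x.2 = 0 := funext fun p ↦ hcomp p x (by rw [hx]; rfl)
  ext1
  · exact hinj (by rw [hψ x h2, hx]; exact (map_zero ψ).symm)
  · exact h2

/-! ### Co-finitely injective groups are Hopfian and torsion-free -/

theorem IsCofinitelyInjective.of_addEquiv {G H : Type*} [AddCommGroup G] [AddCommGroup H]
    (h : IsCofinitelyInjective H) (e : G ≃+ H) : IsCofinitelyInjective G := by
  intro φ hφ
  obtain ⟨m, hm⟩ : ∃ f : (G ⧸ φ.range) → H ⧸ ((e.toAddMonoidHom.comp φ).comp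
      e.symm.toAddMonoidHom).range, Function.Surjective f := by
    refine ⟨QuotientAddGroup.map _ _ e.toAddMonoidHom ?_, fun y ↦ ?_⟩
    · rintro _ ⟨x, rfl⟩
      exact ⟨e x, by simp⟩
    · induction y using QuotientAddGroup.induction_on with | _ y
      exact ⟨QuotientAddGroup.mk (e.symm y), congrArg QuotientAddGroup.mk (e.apply_symm_apply y)⟩
  have := h _ (Finite.of_surjective m hm)
  intro x y hxy
  exact e.injective (this (by simp [hxy]))

theorem IsCofinitelyInjective.isHopfianGroup {G : Type*} [AddCommGroup G]
    (h : IsCofinitelyInjective G) : IsHopfianGroup G := by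
  intro φ hφ
  refine ⟨h φ ?_, hφ⟩
  rw [AddMonoidHom.range_eq_top.2 hφ]
  infer_instance

/-- The `N`-torsion of `ℚ/ℤ` is cyclic, generated by any element of order `N`. -/
theorem AddCircle.mem_zmultiples_of_addOrderOf_nsmul {a b : AddCircle (1 : ℚ)}
    (ha : IsOfFinAddOrder a) (hb : addOrderOf a • b = 0) : b ∈ AddSubgroup.zmultiples a := by
  have hN : 0 < addOrderOf a := ha.addOrderOf_pos
  have : Fact ((0 : ℚ) < 1) := ⟨one_pos⟩
  obtain ⟨m, -, hm, hma⟩ := (AddCircle.addOrderOf_eq_pos_iff hN).1 rfl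
  obtain ⟨b, rfl⟩ := QuotientAddGroup.mk_surjective b
  obtain ⟨k, hk⟩ := AddCircle.coe_eq_zero_iff _ |>.1 hb
  obtain ⟨u, v, huv⟩ := Nat.isCoprime_iff_coprime.2 hm
  refine ⟨k * u, ?_⟩
  have hN' : (addOrderOf a : ℚ) ≠ 0 := by exact_mod_cast hN.ne'
  have hb' : b = k / addOrderOf a := by
    rw [eq_div_iff hN']
    simpa [mul_comm] using hk.symm
  change (k * u) • a = ((b : ℚ) : AddCircle (1 : ℚ))
  conv_lhs => rw [← hma]
  rw [← AddCircle.coe_zsmul, ← sub_eq_zero, ← AddCircle.coe_sub, AddCircle.coe_eq_zero_iff]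
  refine ⟨-(k * v), ?_⟩
  have huv' : (u * m + v * addOrderOf a : ℚ) = 1 := by exact_mod_cast huv
  rw [hb']
  simp only [zsmul_eq_mul, Int.cast_mul, Int.cast_neg, mul_one]
  field_simp
  linear_combination (-k : ℚ) * huv'

/-- An element generating a pure cyclic subgroup of prime power order is fixed by an endomorphism
with finite image. -/
theorem exists_finite_range_apply_eq_self {G : Type*} [AddCommGroup G] {p n : ℕ} (hp : p.Prime)
    {y : G} (hy : p ^ (n + 1) • y = 0) (hn : ∀ z, p ^ (n + 1) • z ≠ p ^ n • y) :
    ∃ r : G →+ G, Finite r.range ∧ r y = y := by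
  let S : AddSubgroup G := (nsmulAddMonoidHom (p ^ (n + 1)) : G →+ G).range
  have hne : QuotientAddGroup.mk' S (p ^ n • y) ≠ 0 := by
    intro h
    obtain ⟨z, hz⟩ := (QuotientAddGroup.eq_zero_iff _).1 h
    exact hn z hz
  -- The induced `χ` has values killed by `p ^ (n + 1)`, the exact order of both `χ y` and `y`.
  -- Every value is thus a multiple of `χ y`, and `r` sends `t • χ y` back to `t • y`.
  obtain ⟨c, hc⟩ := CharacterModule.exists_character_apply_ne_zero_of_ne_zero hne
  let χ : G →+ AddCircle (1 : ℚ) := AddMonoidHom.comp c (QuotientAddGroup.mk' S)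
  have hχ : ∀ g, p ^ (n + 1) • χ g = 0 := by
    intro g
    rw [← map_nsmul]
    have : QuotientAddGroup.mk' S (p ^ (n + 1) • g) = 0 :=
      (QuotientAddGroup.eq_zero_iff _).2 ⟨g, rfl⟩
    change c (QuotientAddGroup.mk' S (p ^ (n + 1) • g)) = 0
    rw [this, map_zero]
  have : Fact p.Prime := ⟨hp⟩
  have hχn : ¬ p ^ n • χ y = 0 := by
    rw [← map_nsmul]
    exact hc
  have hord : addOrderOf (χ y) = p ^ (n + 1) := addOrderOf_eq_prime_pow hχn (hχ y)
  have hordy : addOrderOf y = p ^ (n + 1) := by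
    refine addOrderOf_eq_prime_pow (fun h ↦ hχn ?_) hy
    rw [← map_nsmul, h, map_zero]
  have hfin : IsOfFinAddOrder (χ y) := by
    rw [← addOrderOf_pos_iff, hord]
    exact pow_pos hp.pos _
  have hmem : ∀ g, χ g ∈ AddSubgroup.zmultiples (χ y) := fun g ↦
    AddCircle.mem_zmultiples_of_addOrderOf_nsmul hfin (by rw [hord, hχ])
  choose t ht using hmem
  have hker : ∀ a b : ℤ, a • χ y = b • χ y → a • y = b • y := by
    intro a b hab
    rw [← sub_eq_zero, ← sub_smul, ← addOrderOf_dvd_iff_zsmul_eq_zero] at hab ⊢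
    rwa [hordy, ← hord]
  refine ⟨AddMonoidHom.mk' (fun g ↦ t g • y) fun a b ↦ ?_, ?_, ?_⟩
  · rw [← add_smul]
    apply hker
    have h1 := ht (a + b)
    have h2 := ht a
    have h3 := ht b
    dsimp only at h1 h2 h3
    rw [add_smul, h1, h2, h3, map_add]
  · have : Finite (AddSubgroup.zmultiples y) := by
      refine Set.finite_coe_iff.2 (finite_zmultiples.2 (addOrderOf_pos_iff.1 ?_))
      rw [hordy]
      exact pow_pos hp.pos _
    refine Set.Finite.subset (s := (AddSubgroup.zmultiples y : Set G)) this ?_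
    rintro _ ⟨g, rfl⟩
    exact ⟨t g, rfl⟩
  · have := hker (t y) 1 (by rw [one_smul]; exact ht y)
    rwa [one_smul] at this

theorem IsCofinitelyInjective.exists_smul_eq {G : Type*} [AddCommGroup G]
    (h : IsCofinitelyInjective G) {p : ℕ} (hp : p.Prime) {x : G} (hx : p • x = 0) (n : ℕ) :
    ∃ z, p ^ n • z = x := by
  induction n with
  | zero => exact ⟨x, by simp⟩
  | succ n ih =>
    obtain ⟨y, hy⟩ := ih
    by_contra hn
    push Not at hn
    obtain ⟨r, hr, hry⟩ := exists_finite_range_apply_eq_self hp (n := n) (y := y)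
      (by rw [pow_succ', mul_smul, hy, hx]) (fun z ↦ by rw [hy]; exact hn z)
    -- Modulo the image of `1 - r`, each `g` equals `r g`, which takes finitely many values.
    have hfin : Finite (G ⧸ (AddMonoidHom.id G - r).range) := by
      refine Finite.of_surjective (fun z : r.range ↦ QuotientAddGroup.mk (z : G)) fun q ↦ ?_
      induction q using QuotientAddGroup.induction_on with | _ g
      refine ⟨⟨r g, g, rfl⟩, ?_⟩
      rw [QuotientAddGroup.eq]
      exact ⟨g, by simp [sub_eq_neg_add]⟩
    have hy0 : y = 0 := h _ hfin (by simp [hry])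
    exact hn 0 (by rw [← hy, hy0, smul_zero, smul_zero])

/-- The `p`-primary component of an abelian group. -/
def primaryPart (G : Type*) [AddCommGroup G] (p : ℕ) : AddSubgroup G where
  carrier := {x | ∃ n : ℕ, p ^ n • x = 0}
  zero_mem' := ⟨0, smul_zero _⟩
  add_mem' := by
    rintro a b ⟨m, hm⟩ ⟨n, hn⟩
    refine ⟨m + n, ?_⟩
    rw [smul_add, pow_add, mul_smul _ _ b, hn, mul_comm, mul_smul, hm, smul_zero, smul_zero,
      add_zero]
  neg_mem' := by
    rintro a ⟨n, hn⟩
    exact ⟨n, by rw [smul_neg, hn, neg_zero]⟩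

theorem IsCofinitelyInjective.isAddTorsionFree {G : Type*} [AddCommGroup G]
    (h : IsCofinitelyInjective G) : IsAddTorsionFree G := by
  have hprime : ∀ p : ℕ, p.Prime → ∀ x : G, p • x = 0 → x = 0 := by
    intro p hp
    let T := primaryPart G p
    have hdivp : ∀ (n : ℕ) (x : G), p ^ n • x = 0 → ∃ y ∈ T, p • y = x := by
      intro n
      induction n with
      | zero => exact fun x hx ↦ ⟨0, T.zero_mem, by simpa using hx.symm⟩
      | succ n ih =>
        intro x hx
        -- The element `p ^ n • x` is killed by `p`, so it has infinite height; writing it as `p ^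
        -- (n + 1) • z` makes `p ^ n` kill `x - p • z`.
        obtain ⟨z, hz⟩ := h.exists_smul_eq hp (x := p ^ n • x)
          (by rw [← mul_smul, ← pow_succ', hx]) (n + 1)
        obtain ⟨y, hy, hyx⟩ := ih (x - p • z) (by
          rw [smul_sub, ← mul_smul, ← pow_succ, hz, sub_self])
        have hzT : z ∈ T := ⟨n + 1 + 1, by
          rw [pow_succ', mul_smul, hz, ← mul_smul, ← pow_succ', hx]⟩
        exact ⟨y + z, T.add_mem hy hzT, by rw [smul_add, hyx]; abel⟩
    have hdiv : ∀ n : ℕ, n ≠ 0 → Function.Surjective fun x : T ↦ n • x := by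
      intro n
      induction n using Nat.recOnMul with
      | zero => simp
      | one => exact fun _ x ↦ ⟨x, one_smul _ x⟩
      | prime q hq =>
        rintro - ⟨x, k, hx⟩
        by_cases hqp : q = p
        · subst hqp
          obtain ⟨y, hy, rfl⟩ := hdivp k x hx
          exact ⟨⟨y, hy⟩, rfl⟩
        · obtain ⟨u, v, huv⟩ := Nat.isCoprime_iff_coprime.2
            (Nat.Coprime.pow_right k ((Nat.coprime_primes hq hp).2 hqp))
          refine ⟨u • ⟨x, k, hx⟩, Subtype.ext ?_⟩
          change q • (u • x) = x
          calc q • (u • x) = (u * q) • x := by rw [← natCast_zsmul, smul_smul, mul_comm]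
            _ = (u * q + v * (p ^ k : ℕ)) • x := by
              rw [add_smul, mul_smul v, natCast_zsmul, hx, smul_zero, add_zero]
            _ = x := by rw [huv, one_smul]
      | mul a b iha ihb =>
        intro hab x
        obtain ⟨y, rfl⟩ := iha (left_ne_zero_of_mul hab) x
        obtain ⟨z, rfl⟩ := ihb (right_ne_zero_of_mul hab) y
        exact ⟨z, mul_smul _ _ _⟩
    let : DivisibleBy T ℤ := divisibleByOfSMulRightSurj _ _ fun {n} hn x ↦ by
      obtain ⟨y, hy⟩ := hdiv n.natAbs (by simpa) x
      rcases Int.natAbs_eq n with h | h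
      · refine ⟨y, ?_⟩
        dsimp only at hy ⊢
        rw [h, natCast_zsmul, hy]
      · refine ⟨-y, ?_⟩
        dsimp only at hy ⊢
        rw [h, neg_smul_neg, natCast_zsmul, hy]
    obtain ⟨ρ, hρ⟩ := Module.Baer.extension_property_addMonoidHom
      (Module.Baer.of_divisible T) T.subtype Subtype.val_injective (AddMonoidHom.id _)
    replace hρ : ∀ x : T, ρ x = x := fun x ↦ DFunLike.congr_fun hρ x
    -- Multiplication by `p` on `T`, the identity on `ker ρ`.
    let φ : G →+ G := AddMonoidHom.id G - T.subtype.comp ρ + p • T.subtype.comp ρ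
    have hφ : ∀ g, φ g = g - ρ g + p • (ρ g : G) := fun g ↦ rfl
    have hs : Function.Surjective φ := by
      intro g
      obtain ⟨t, ht⟩ := hdiv p hp.ne_zero (ρ g)
      refine ⟨g - ρ g + t, ?_⟩
      have ht' : p • (t : G) = ρ g := congrArg Subtype.val ht
      have : ρ (g - ρ g + t) = t := by rw [map_add, map_sub, hρ, hρ, sub_self, zero_add]
      rw [hφ, this, ht']
      abel
    intro x hx
    apply (h.isHopfianGroup φ hs).1
    have : (ρ x : G) = x := congrArg Subtype.val (hρ ⟨x, 1, by rw [pow_one, hx]⟩)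
    rw [hφ, this, map_zero, hx, sub_self, add_zero]
  have hnat : ∀ n : ℕ, n ≠ 0 → ∀ x : G, n • x = 0 → x = 0 := by
    intro n
    induction n using Nat.recOnMul with
    | zero => simp
    | one => simp
    | prime p hp => exact fun _ ↦ hprime p hp
    | mul a b iha ihb =>
      intro hab x hx
      rw [mul_smul] at hx
      exact ihb (right_ne_zero_of_mul hab) x (iha (left_ne_zero_of_mul hab) _ hx)
  refine ⟨fun n hn x y hxy ↦ ?_⟩
  rw [← sub_eq_zero]
  apply hnat n hn
  rw [smul_sub]
  exact sub_eq_zero.2 hxy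

theorem proposition4p2 {G : Type u} [AddCommGroup G] (hG : IsCotorsionGroup G) :
    List.TFAE
      [IsCofinitelyInjective G,
        IsAddTorsionFree G ∧ IsHopfianGroup G,
        ∃ (n : ℕ) (k : Nat.Primes → ℕ),
          Nonempty (G ≃+ (Fin n → ℚ) × ((p : Nat.Primes) → (Fin (k p) → ℤ_[p])))] := by
  tfae_have 1 → 2 := fun h ↦ ⟨h.isAddTorsionFree, h.isHopfianGroup⟩
  tfae_have 2 → 3 := fun ⟨_, h⟩ ↦ hG.exists_addEquiv_of_isHopfianGroup h
  tfae_have 3 → 1 := fun ⟨n, k, ⟨e⟩⟩ ↦ (isCofinitelyInjective_rat_prod_padicInt n k).of_addEquiv e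
  tfae_finish
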